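/- Theorem. For a finite group $G$, let $\mu(G)$ denote its minimal faithful permutation degree, i.e. the least non-negative integer $m$ such that $G$ embeds in the symmetric group $\mathrm{Sym}(m)$. For $n\ge 2$, let $W(D_n)$ be the Coxeter group of type $D_n$: the group generated by $s_0,\dots,s_{n-1}$ subject to the relations $s_i^2=1$, $(s_is_j)^3=1$ whenever $\{i,j\}=\{0,2\}$ or $\{i,j\}=\{k,k+1\}$ with $1\le k\le n-2$, and $(s_is_j)^2=1$ for all other $i\ne j$. (In particular $W(D_2)\cong C_2\times C_2$ and $W(D_3)\cong \mathrm{Sym}(4)$.) Then for every integer $n\ge 2$, $$\mu(W(D_n))=\begin{cases}4 & \text{if } n=3,\\ 2n & \text{if } n\neq 3.\end{cases}$$ -/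

import Mathlib

/-- The minimal faithful permutation degree `μ(G)` of a group `G`: the least natural number `m` such
that `G` embeds in the symmetric group on `m` points. (For a group with no such `m` the infimum is
`0`; a nonzero value is always attained by an embedding.) -/
noncomputable def minFaithfulPermDegree (G : Type*) [Group G] : ℕ :=
  sInf {m : ℕ | ∃ f : G →* Equiv.Perm (Fin m), Function.Injective f}

/-- The edges `{i, j}`, with `i < j`, of the Coxeter–Dynkin diagram of type `D_n` on the nodes
`0, …, n - 1`, all of them unlabelled:
```
    0
     \
      2 --- 3 --- 4 ⬝ ⬝ ⬝ ⬝ (n-1)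
     /
    1
```
For `n = 2` this leaves the two unconnected nodes `0` and `1` (type `A_1 × A_1`), and for `n = 3` the
path `0 --- 2 --- 1` (type `A_3`). -/
def IsEdgeD (i j : ℕ) : Prop :=
  (i = 0 ∧ j = 2) ∨ (1 ≤ i ∧ j = i + 1)

instance (i j : ℕ) : Decidable (IsEdgeD i j) :=
  inferInstanceAs (Decidable ((i = 0 ∧ j = 2) ∨ (1 ≤ i ∧ j = i + 1)))

/-- The Coxeter matrix of type `D_n`: entry `1` on the diagonal, `3` for adjacent nodes of the
diagram, and `2` otherwise. (Mathlib's `CoxeterMatrix.D` also joins its last two nodes, so that its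
diagram contains a triangle; hence it is not used here.) -/
def coxeterMatrixD (n : ℕ) : CoxeterMatrix (Fin n) where
  M := Matrix.of fun i j : Fin n ↦
    if i = j then 1 else if IsEdgeD i j ∨ IsEdgeD j i then 3 else 2
  isSymm := by
    refine Matrix.IsSymm.ext fun i j ↦ ?_
    simp only [Matrix.of_apply, eq_comm (a := j) (b := i), or_comm (a := IsEdgeD j i)]
  diagonal i := by simp
  off_diagonal i j h := by
    simp only [Matrix.of_apply, if_neg h]
    split_ifs <;> decide

/-- The Coxeter group `W(D_n)`, given by its Coxeter presentation. -/
abbrev CoxeterGroupD (n : ℕ) : Type := (coxeterMatrixD n).Group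

/-!
The group `W(D_n)` is identified with the group of signed permutations of `n` letters with an even
number of sign changes. The only difficulty is that the signed permutation representation is
faithful. This is proved by induction on `n`: the generators of `W(D_{n+1})` act on the cosets of
the parabolic subgroup `W(D_n)` just as they act on the `2 * (n + 1)` signed basis vectors
(`orbit_of_fixed_point`, `CoxeterGroupD.exists_equivariant`), so this parabolic subgroup is the full
stabilizer of the last basis vector, and the kernel of the representation lies in it. The image is
found by generating all permutations and all even sign changes
(`CoxeterGroupD.range_toSignedPerm`), which gives the order `2 ^ (n - 1) * n!`.

Upper bounds: `W(D_n)` acts faithfully on the `2 * n` signed basis vectors, and `W(D_3)` maps onto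
the symmetric group of degree `4`, which has the same order.

Lower bounds: for `n ≤ 4` the order of the group has to divide `m!`, and this suffices. For `n ≥ 5`
every subgroup `H` of index less than `2 * n` contains the normal subgroup `V` of even sign changes
(`SignedPerm.signVec_mem_signSubgroup`), so that `V` acts trivially on any set with fewer than
`2 * n` points. Indeed, if `H` does not contain `V`, then `H V` has index less than `n`, whence the
image of `H` in the symmetric group contains the alternating group
(`alternatingGroup_le_of_index_lt`). So `H ∩ V` is a proper subgroup of `V` which is stable under
the alternating group, and it can only consist of constant sign vectors
(`SignedPerm.signVec_pair_mem`). Then the sign changes of the `n.choose 2` pairs of coordinates lie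
in distinct cosets of `H`, although `2 * n ≤ n.choose 2`.
-/

/-! ### Signed permutations -/

/-- The group of signed permutations of `n` letters, the pair `(v, σ)` standing for the monomial
map which sends the basis vector `e i` to `v (σ i) • e (σ i)`. -/
abbrev SignedPerm (n : ℕ) : Type := (Fin n → ℤˣ) ⋊[mulAutArrow] Equiv.Perm (Fin n)

namespace SignedPerm

variable {n : ℕ}

theorem mul_left_apply (g h : SignedPerm n) (i : Fin n) :
    (g * h).left i = g.left i * h.left (g.right⁻¹ i) := rfl

/-- The action of a signed permutation on the `2 * n` signed basis vectors, the pair `(i, ε)`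
standing for `ε • e i`. -/
def toPerm (n : ℕ) : SignedPerm n →* Equiv.Perm (Fin n × ℤˣ) :=
  MonoidHom.toHomPerm
    { toFun := fun g x ↦ (g.right x.1, g.left (g.right x.1) * x.2)
      map_one' := by
        funext x
        simp [Function.End.one_def]
      map_mul' := fun g h ↦ by
        funext x
        change _ = (g.right (h.right x.1),
          g.left (g.right (h.right x.1)) * (h.left (h.right x.1) * x.2))
        simp [mul_left_apply, mul_assoc] }

theorem toPerm_apply (g : SignedPerm n) (x : Fin n × ℤˣ) :
    toPerm n g x = (g.right x.1, g.left (g.right x.1) * x.2) := rfl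

theorem toPerm_injective (n : ℕ) : Function.Injective (toPerm n) := by
  intro g h hgh
  have key (i : Fin n) : g.right i = h.right i ∧ g.left (g.right i) = h.left (h.right i) := by
    have := congrArg (fun p : Equiv.Perm (Fin n × ℤˣ) ↦ p (i, 1)) hgh
    simpa [toPerm_apply] using this
  have hr : g.right = h.right := Equiv.ext fun i ↦ (key i).1
  refine SemidirectProduct.ext (funext fun i ↦ ?_) hr
  simpa [hr] using (key (g.right⁻¹ i)).2

/-- The product of all the signs of a signed permutation. -/
def parity (n : ℕ) : SignedPerm n →* ℤˣ where
  toFun g := ∏ i, g.left i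
  map_one' := by simp
  map_mul' g h := by
    simp only [mul_left_apply, Finset.prod_mul_distrib]
    rw [Equiv.prod_comp g.right⁻¹ h.left]

theorem parity_apply (g : SignedPerm n) : parity n g = ∏ i, g.left i := rfl

/-- The sign vector which is `-1` exactly on `s`. -/
def signVec (s : Finset (Fin n)) : Fin n → ℤˣ := fun i ↦ if i ∈ s then -1 else 1

theorem prod_signVec (s : Finset (Fin n)) : ∏ i, signVec s i = (-1) ^ s.card := by
  simp [signVec]

/-- For `a ≠ b`, the reflection in `e a - ε • e b`, exchanging `e a` and `ε • e b`. -/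
def reflection (a b : Fin n) (ε : ℤˣ) : SignedPerm n :=
  ⟨fun i ↦ if i = a ∨ i = b then ε else 1, Equiv.swap a b⟩

theorem reflection_mul_self (a b : Fin n) (ε : ℤˣ) : reflection a b ε * reflection a b ε = 1 := by
  refine SemidirectProduct.ext (funext fun i ↦ ?_) (Equiv.swap_mul_self a b)
  rw [mul_left_apply]
  simp only [reflection, Equiv.swap_inv, SemidirectProduct.one_left, Pi.one_apply]
  by_cases ha : i = a
  · subst ha; simp
  by_cases hb : i = b
  · subst hb; simp
  · simp [ha, hb, Equiv.swap_apply_of_ne_of_ne ha hb]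

theorem reflection_commute_same (a b : Fin n) (ε δ : ℤˣ) :
    reflection a b ε * reflection a b δ = reflection a b δ * reflection a b ε := by
  refine SemidirectProduct.ext (funext fun i ↦ ?_) rfl
  simp only [mul_left_apply]
  simp only [reflection, Equiv.swap_inv]
  by_cases ha : i = a
  · subst ha; simp [mul_comm]
  by_cases hb : i = b
  · subst hb; simp [mul_comm]
  · simp [ha, hb, Equiv.swap_apply_of_ne_of_ne ha hb]

theorem reflection_commute {a b c d : Fin n} (hac : a ≠ c) (had : a ≠ d) (hbc : b ≠ c)
    (hbd : b ≠ d) (ε δ : ℤˣ) : reflection a b ε * reflection c d δ = reflection c d δ * reflection a b ε := by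
  refine SemidirectProduct.ext (funext fun i ↦ ?_) ?_
  · simp only [mul_left_apply]
    simp only [reflection, Equiv.swap_inv]
    by_cases ha : i = a
    · subst ha
      simp [hac, had, hbc, hbd, Equiv.swap_apply_of_ne_of_ne hac had]
    by_cases hb : i = b
    · subst hb
      simp [hac, had, hbc, hbd, Equiv.swap_apply_of_ne_of_ne hbc hbd]
    rw [Equiv.swap_apply_of_ne_of_ne ha hb]
    by_cases hc : i = c
    · subst hc
      simp [ha, hb, had.symm, hbd.symm]
    by_cases hd : i = d
    · subst hd
      simp [ha, hb, hac.symm, hbc.symm]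
    · simp [ha, hb, hc, hd, Equiv.swap_apply_of_ne_of_ne hc hd]
  · simp only [SemidirectProduct.mul_right, reflection]
    ext i
    simp only [Equiv.Perm.mul_apply]
    grind

theorem reflection_braid {a b c : Fin n} (hab : a ≠ b) (hbc : b ≠ c) (hac : a ≠ c) (ε δ : ℤˣ) :
    reflection a b ε * reflection b c δ * reflection a b ε =
      reflection b c δ * reflection a b ε * reflection b c δ := by
  refine SemidirectProduct.ext (funext fun i ↦ ?_) ?_
  · simp only [mul_left_apply, SemidirectProduct.mul_right, mul_inv_rev, Equiv.Perm.mul_apply]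
    simp only [reflection, Equiv.swap_inv]
    have h1 : ε * ε = 1 := Int.units_mul_self ε
    have h2 : δ * δ = 1 := Int.units_mul_self δ
    by_cases ha : i = a
    · subst ha
      simp [hab, hac, hbc, hac.symm, hbc.symm,
        Equiv.swap_apply_of_ne_of_ne hab hac, mul_comm]
    by_cases hb : i = b
    · subst hb
      simp [hab, hac, hbc, hac.symm, hbc.symm, hab.symm, h1, h2,
        Equiv.swap_apply_of_ne_of_ne hab hac, Equiv.swap_apply_of_ne_of_ne hac.symm hbc.symm]
    by_cases hc : i = c
    · subst hc
      simp [hab, hac, hac.symm, hbc.symm, hab.symm,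
        Equiv.swap_apply_of_ne_of_ne hac.symm hbc.symm, mul_comm]
    · simp [ha, hb, hc, Equiv.swap_apply_of_ne_of_ne hb hc, Equiv.swap_apply_of_ne_of_ne ha hb]
  · simp only [SemidirectProduct.mul_right, reflection]
    ext i
    simp only [Equiv.Perm.mul_apply]
    grind

end SignedPerm

/-! ### The presentation of type `D` and its signed permutation representation -/

open SignedPerm

namespace CoxeterGroupD

variable {n : ℕ}

/-- The generator `s i` of `W(D_n)`, for a natural number `i < n`. -/
def gen (n i : ℕ) (hi : i < n) : CoxeterGroupD n := (coxeterMatrixD n).simple ⟨i, hi⟩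

theorem coxeterMatrixD_apply (i j : Fin n) : (coxeterMatrixD n).M i j =
    if i = j then 1 else if IsEdgeD i j ∨ IsEdgeD j i then 3 else 2 := rfl

theorem gen_mul_self {i : ℕ} (hi : i < n) : gen n i hi * gen n i hi = 1 :=
  (coxeterMatrixD n).toCoxeterSystem.simple_mul_simple_self ⟨i, hi⟩

theorem gen_mul_pow {i j : ℕ} (hi : i < n) (hj : j < n) :
    (gen n i hi * gen n j hj) ^ (coxeterMatrixD n).M ⟨i, hi⟩ ⟨j, hj⟩ = 1 :=
  (coxeterMatrixD n).toCoxeterSystem.simple_mul_simple_pow ⟨i, hi⟩ ⟨j, hj⟩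

theorem gen_commute {i j : ℕ} (hi : i < n) (hj : j < n) (h : ¬ IsEdgeD i j) (h' : ¬ IsEdgeD j i) :
    gen n i hi * gen n j hj = gen n j hj * gen n i hi := by
  by_cases hij : i = j
  · subst hij; rfl
  have := gen_mul_pow hi hj
  rw [coxeterMatrixD_apply, if_neg (by simpa using hij), if_neg (by simp [h, h']), pow_two,
    mul_eq_one_iff_eq_inv, mul_inv_rev, inv_eq_of_mul_eq_one_right (gen_mul_self hi),
    inv_eq_of_mul_eq_one_right (gen_mul_self hj)] at this
  exact this

theorem gen_braid {i j : ℕ} (hi : i < n) (hj : j < n) (h : IsEdgeD i j) :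
    gen n i hi * gen n j hj * gen n i hi = gen n j hj * gen n i hi * gen n j hj := by
  have hij : i ≠ j := by
    rcases h with h | h <;> lia
  have := gen_mul_pow hi hj
  rw [coxeterMatrixD_apply, if_neg (by simpa using hij), if_pos (Or.inl h)] at this
  have key : (gen n i hi * gen n j hj * gen n i hi) * (gen n j hj * gen n i hi * gen n j hj) = 1 := by
    simpa [pow_succ, mul_assoc] using this
  rw [mul_eq_one_iff_eq_inv] at key
  simpa [inv_eq_of_mul_eq_one_right (gen_mul_self hi),
    inv_eq_of_mul_eq_one_right (gen_mul_self hj), mul_assoc] using key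

theorem induction_left {p : CoxeterGroupD n → Prop} (w : CoxeterGroupD n) (one : p 1)
    (mul : ∀ (i : ℕ) (hi : i < n) (w : CoxeterGroupD n), p w → p (gen n i hi * w)) : p w :=
  (coxeterMatrixD n).toCoxeterSystem.simple_induction_left w one fun w i hw ↦ mul i i.2 w hw

/-- A family of involutions satisfying the commutation and braid relations of the diagram `D_n`
defines a homomorphism from `W(D_n)`. -/
theorem isLiftable {G : Type*} [Group G] {f : Fin n → G} (sq : ∀ i, f i * f i = 1)
    (comm : ∀ i j : Fin n, i < j → ¬ IsEdgeD i j → f i * f j = f j * f i)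
    (braid : ∀ i j : Fin n, IsEdgeD i j → f i * f j * f i = f j * f i * f j) :
    (coxeterMatrixD n).IsLiftable f := by
  have braid' (i j : Fin n) (h : IsEdgeD i j ∨ IsEdgeD j i) :
      f i * f j * f i = f j * f i * f j := by
    rcases h with h | h
    · exact braid i j h
    · exact (braid j i h).symm
  have comm' (i j : Fin n) (h : ¬ (IsEdgeD i j ∨ IsEdgeD j i)) : f i * f j = f j * f i := by
    rcases lt_trichotomy i j with hij | hij | hij
    · exact comm i j hij (by tauto)
    · rw [hij]
    · exact (comm j i hij (by tauto)).symm
  intro i j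
  rw [coxeterMatrixD_apply]
  split_ifs with hij h
  · rw [pow_one, hij, sq]
  · calc (f i * f j) ^ 3 = (f i * f j * f i) * (f j * f i * f j) := by
          simp only [pow_succ, pow_zero, one_mul, mul_assoc]
      _ = (f i * f j * f i) * (f i * f j * f i) := by rw [braid' i j h]
      _ = f i * (f j * (f i * f i) * f j) * f i := by simp only [mul_assoc]
      _ = 1 := by rw [sq, mul_one, sq, mul_one, sq]
  · calc (f i * f j) ^ 2 = (f i * f j) * (f i * f j) := pow_two _
      _ = (f i * f j) * (f j * f i) := by rw [comm' i j h]
      _ = f i * (f j * f j) * f i := by simp only [mul_assoc]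
      _ = 1 := by rw [sq, mul_one, sq]

/-- The homomorphism from `W(D_n)` given by images of the generators satisfying the relations. -/
def lift {G : Type*} [Group G] {f : Fin n → G} (hf : (coxeterMatrixD n).IsLiftable f) :
    CoxeterGroupD n →* G :=
  (coxeterMatrixD n).toCoxeterSystem.lift ⟨f, hf⟩

theorem lift_gen {G : Type*} [Group G] {f : Fin n → G} (hf : (coxeterMatrixD n).IsLiftable f)
    {i : ℕ} (hi : i < n) : lift hf (gen n i hi) = f ⟨i, hi⟩ :=
  (coxeterMatrixD n).toCoxeterSystem.lift_apply_simple hf ⟨i, hi⟩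

/-- The image of the generator `s i` as a signed permutation. With coordinates numbered from `0`,
it is the reflection in `e (i - 1) - e i` for `1 ≤ i`, and the reflection in `e 0 + e 1` for
`i = 0`. -/
def signedGen (hn : 2 ≤ n) (i : Fin n) : SignedPerm n :=
  reflection ⟨i - 1, by lia⟩ ⟨max i 1, by lia⟩ (if (i : ℕ) = 0 then -1 else 1)

theorem isLiftable_signedGen (hn : 2 ≤ n) : (coxeterMatrixD n).IsLiftable (signedGen hn) := by
  refine isLiftable (fun i ↦ reflection_mul_self _ _ _) (fun i j hij h ↦ ?_) fun i j h ↦ ?_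
  · by_cases h1 : (i : ℕ) = 0 ∧ (j : ℕ) = 1
    · have hi : i = ⟨0, by lia⟩ := Fin.ext h1.1
      have hj : j = ⟨1, by lia⟩ := Fin.ext h1.2
      rw [hi, hj]
      exact reflection_commute_same _ _ _ _
    · unfold IsEdgeD at h
      have hij' : (i : ℕ) < j := hij
      apply reflection_commute <;> simp only [ne_eq, Fin.mk.injEq] <;> lia
  · have : (max i 1 : ℕ) = j - 1 ∧ (i : ℕ) < j ∧ 2 ≤ (j : ℕ) := by
      unfold IsEdgeD at h; lia
    unfold signedGen
    simp only [this.1]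
    apply reflection_braid <;> simp only [ne_eq, Fin.mk.injEq] <;> lia

/-- The representation of `W(D_n)` by signed permutations. -/
def toSignedPerm (hn : 2 ≤ n) : CoxeterGroupD n →* SignedPerm n := lift (isLiftable_signedGen hn)

theorem toSignedPerm_gen (hn : 2 ≤ n) {i : ℕ} (hi : i < n) :
    toSignedPerm hn (gen n i hi) = signedGen hn ⟨i, hi⟩ := lift_gen _ _

end CoxeterGroupD

/-! ### Faithfulness of the signed permutation representation -/

/-- The action of generators `s 0, …, s n` of type `D_{n+1}` on the orbit of a point `p n` which is
fixed by `s 0, …, s (n - 1)`. The orbit consists of the points `p k` and `q k`, which are to be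
thought of as the signed basis vectors `e k` and `-e k`, and `s` acts on it by signed
permutations. -/
theorem orbit_of_fixed_point {X : Type*} {n : ℕ} (hn : 2 ≤ n) {s : ℕ → X → X}
    (sq : ∀ i ≤ n, ∀ x, s i (s i x) = x)
    (comm : ∀ i ≤ n, ∀ j ≤ n, ¬ IsEdgeD i j → ¬ IsEdgeD j i → ∀ x, s i (s j x) = s j (s i x))
    (braid : ∀ i ≤ n, ∀ j ≤ n, IsEdgeD i j ∨ IsEdgeD j i →
      ∀ x, s i (s j (s i x)) = s j (s i (s j x)))
    {p q : ℕ → X} (hp : ∀ i < n, s i (p n) = p n)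
    (hp' : ∀ k < n, p k = s (k + 1) (p (k + 1))) (hq0 : q 0 = s 0 (p 1))
    (hq' : ∀ k < n, q (k + 1) = s (k + 1) (q k)) :
    (∀ k ≤ n, ∀ i ≤ n, i ≠ k → i ≠ k + 1 → (i = 0 → 2 ≤ k) → s i (p k) = p k) ∧
    (∀ k ≤ n, ∀ i ≤ n, i ≠ k → i ≠ k + 1 → (i = 0 → 2 ≤ k) → s i (q k) = q k) ∧
    s 0 (p 0) = q 1 := by
  -- Moving down from `p (k + 1)` to `p k = s (k + 1) (p (k + 1))`: every generator commutes with
  -- `s (k + 1)`, except for `s (k + 2)`, where the braid relation is used, and those excluded.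
  have hpfix : ∀ k ≤ n, ∀ i ≤ n, i ≠ k → i ≠ k + 1 → (i = 0 → 2 ≤ k) → s i (p k) = p k := by
    intro k hk
    induction hd : n - k using Nat.strong_induction_on generalizing k with
    | _ d ih =>
    intro i hi h1 h2 h3
    rcases hk.eq_or_lt with rfl | hk
    · exact hp i (by lia)
    rw [hp' k hk]
    by_cases h : i = k + 2
    · subst h
      rw [hp' (k + 1) (by lia), braid _ hi (k + 1) hk (by unfold IsEdgeD; lia),
        ih (n - (k + 2)) (by lia) (k + 2) hi rfl (k + 1) (by lia) (by lia) (by lia) (by lia)]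
    · rw [comm i hi (k + 1) hk (by unfold IsEdgeD; lia) (by unfold IsEdgeD; lia),
        ih (n - (k + 1)) (by lia) (k + 1) hk rfl i hi h2 h (by lia)]
  have hq1 : s 0 (p 0) = q 1 := by
    rw [hq' 0 (by lia), hq0, hp' 0 (by lia)]
    exact comm 0 (by lia) 1 (by lia) (by unfold IsEdgeD; lia) (by unfold IsEdgeD; lia) _
  refine ⟨hpfix, fun k hk ↦ ?_, hq1⟩
  induction k using Nat.strong_induction_on with
  | _ k ih =>
  intro i hi h1 h2 h3
  match k with
  | 0 =>
    rw [hq0]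
    by_cases h : i = 2
    · subst h
      rw [hp' 1 (by lia), braid 2 hi 0 (by lia) (by unfold IsEdgeD; lia),
        hpfix 2 hi 0 (by lia) (by lia) (by lia) (by lia)]
    · rw [comm i hi 0 (by lia) (by unfold IsEdgeD; lia) (by unfold IsEdgeD; lia),
        hpfix 1 (by lia) i hi (by lia) (by lia) (by lia)]
  | k + 1 =>
    rw [hq' k hk]
    by_cases h : i = k
    · obtain ⟨k, rfl⟩ : ∃ j, k = j + 1 := ⟨k - 1, by lia⟩
      subst h
      rw [hq' k (by lia), braid (k + 1) hi (k + 1 + 1) hk (by unfold IsEdgeD; lia),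
        ih k (by lia) (by lia) (k + 1 + 1) hk (by lia) (by lia) (by lia)]
    · by_cases h' : i = 0 ∧ k = 1
      · obtain ⟨rfl, rfl⟩ := h'
        rw [← hq1, braid 0 hi 2 hk (by unfold IsEdgeD; lia),
          hpfix 0 (by lia) 2 hk (by lia) (by lia) (by lia)]
      · rw [comm i hi (k + 1) hk (by unfold IsEdgeD; lia) (by unfold IsEdgeD; lia),
          ih k (by lia) (by lia) i hi h h1 (by lia)]

namespace CoxeterGroupD

variable {n : ℕ}

/-- The action of `W(D_n)` on the signed basis vectors. -/
def toPerm (hn : 2 ≤ n) : CoxeterGroupD n →* Equiv.Perm (Fin n × ℤˣ) :=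
  (SignedPerm.toPerm n).comp (toSignedPerm hn)

theorem toPerm_gen_of_pos (hn : 2 ≤ n) {i : ℕ} (hi : i < n) (hi0 : i ≠ 0) (x : Fin n × ℤˣ) :
    toPerm hn (gen n i hi) x = (Equiv.swap ⟨i - 1, by lia⟩ ⟨i, hi⟩ x.1, x.2) := by
  have hmax : max i 1 = i := by lia
  simp [toPerm, toSignedPerm_gen, SignedPerm.toPerm_apply, signedGen, reflection, hi0, hmax]

theorem toPerm_gen_zero (hn : 2 ≤ n) (x : Fin n × ℤˣ) :
    toPerm hn (gen n 0 (by lia)) x =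
      (Equiv.swap ⟨0, by lia⟩ ⟨1, hn⟩ x.1, if (x.1 : ℕ) < 2 then -x.2 else x.2) := by
  obtain ⟨k, ε⟩ := x
  simp only [toPerm, MonoidHom.comp_apply, toSignedPerm_gen, SignedPerm.toPerm_apply, signedGen,
    reflection]
  by_cases h0 : k = ⟨0, by lia⟩
  · subst h0; simp
  by_cases h1 : k = ⟨1, hn⟩
  · subst h1; simp
  · have h2 : ¬ (k : ℕ) < 2 := by
      simp only [Fin.ext_iff] at h0 h1
      lia
    simp [Equiv.swap_apply_of_ne_of_ne h0 h1, h0, h1, h2]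

/-- The homomorphism `W(D_n) → W(D_{n+1})` onto the parabolic subgroup on the first `n`
generators. -/
def incl (n : ℕ) : CoxeterGroupD n →* CoxeterGroupD (n + 1) :=
  lift (f := fun i ↦ gen (n + 1) i (by lia)) <|
    isLiftable (fun _ ↦ gen_mul_self _)
      (fun i j hij h ↦ gen_commute _ _ h (by have : (i : ℕ) < j := hij; unfold IsEdgeD; lia))
      (fun _ _ h ↦ gen_braid _ _ h)

theorem incl_gen {i : ℕ} (hi : i < n) : incl n (gen n i hi) = gen (n + 1) i (by lia) :=
  lift_gen _ _

theorem toPerm_incl (hn : 2 ≤ n) (w : CoxeterGroupD n) (x : Fin n × ℤˣ) :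
    toPerm (by lia) (incl n w) (x.1.castSucc, x.2) =
      ((toPerm hn w x).1.castSucc, (toPerm hn w x).2) := by
  induction w using induction_left with
  | one => simp
  | mul i hi w ih =>
    rw [map_mul, map_mul, map_mul, Equiv.Perm.mul_apply, ih, incl_gen, Equiv.Perm.mul_apply]
    generalize toPerm hn w x = y
    obtain ⟨k, ε⟩ := y
    by_cases hi0 : i = 0
    · subst hi0
      rw [toPerm_gen_zero, toPerm_gen_zero]
      refine Prod.ext ?_ rfl
      exact ((Fin.castSucc_injective n).map_swap ⟨0, hi⟩ ⟨1, hn⟩ k).symm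
    · rw [toPerm_gen_of_pos _ _ hi0, toPerm_gen_of_pos _ _ hi0]
      refine Prod.ext ?_ rfl
      exact ((Fin.castSucc_injective n).map_swap ⟨i - 1, by lia⟩ ⟨i, hi⟩ k).symm

/-- A point fixed by the parabolic subgroup on the first `n` generators is the image of the last
basis vector under an equivariant map from the signed basis vectors. -/
theorem exists_equivariant (hn : 2 ≤ n) {X : Type*} [MulAction (CoxeterGroupD (n + 1)) X] (x₀ : X)
    (hx₀ : ∀ i (hi : i < n), gen (n + 1) i (by lia) • x₀ = x₀) :
    ∃ f : Fin (n + 1) × ℤˣ → X, f (Fin.last n, 1) = x₀ ∧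
      ∀ w y, f (toPerm (by lia) w y) = w • f y := by
  -- The generators, as maps indexed by all natural numbers.
  let s : ℕ → X → X := fun i x ↦ if h : i < n + 1 then gen (n + 1) i h • x else x
  have hs (i : ℕ) (h : i ≤ n) (x : X) : s i x = gen (n + 1) i (by lia) • x :=
    dif_pos (Nat.lt_succ_of_le h)
  let P : ℕ → X := Nat.rec x₀ fun j x ↦ s (n - j) x
  -- The images of the basis vectors `e k` and of their negatives.
  let p : ℕ → X := fun k ↦ P (n - k)
  let q : ℕ → X := Nat.rec (s 0 (p 1)) fun k x ↦ s (k + 1) x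
  have hpn : p n = x₀ := by simp [p, P]
  have sq : ∀ i ≤ n, ∀ x, s i (s i x) = x := fun i hi x ↦ by
    rw [hs i hi, hs i hi, smul_smul, gen_mul_self, one_smul]
  have hp' : ∀ k < n, p k = s (k + 1) (p (k + 1)) := fun k hk ↦ by
    have h1 : n - k = (n - (k + 1)) + 1 := by lia
    have h2 : n - (n - (k + 1)) = k + 1 := by lia
    simp only [p]
    rw [h1]
    change s (n - (n - (k + 1))) (P (n - (k + 1))) = _
    rw [h2]
  have hq0 : q 0 = s 0 (p 1) := rfl
  have hq' : ∀ k < n, q (k + 1) = s (k + 1) (q k) := fun k hk ↦ rfl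
  obtain ⟨hpf, hqf, hpq⟩ := orbit_of_fixed_point hn sq
    (fun i hi j hj h h' x ↦ by
      rw [hs i hi, hs j hj, hs j hj, hs i hi, smul_smul, smul_smul, gen_commute _ _ h h'])
    (fun i hi j hj h x ↦ by
      simp only [hs i hi, hs j hj, smul_smul, ← mul_assoc]
      rcases h with h | h
      · rw [gen_braid _ _ h]
      · rw [gen_braid _ _ h])
    (fun i hi ↦ by rw [hpn, hs i hi.le, hx₀ i hi]) hp' hq0 hq'
  refine ⟨fun y ↦ if y.2 = 1 then p y.1 else q y.1, by simp [hpn], fun w y ↦ ?_⟩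
  clear_value p q s
  induction w using induction_left generalizing y with
  | one => simp
  | mul i hi w ih =>
    rw [map_mul, Equiv.Perm.mul_apply, mul_smul, ← ih]
    generalize toPerm _ w y = z
    obtain ⟨⟨k, hk⟩, ε⟩ := z
    rw [← hs i (by lia)]
    have hneg : (-1 : ℤˣ) ≠ 1 := by decide
    by_cases hi0 : i = 0
    · subst hi0
      rw [toPerm_gen_zero]
      match k with
      | 0 =>
        rcases Int.units_eq_one_or ε with rfl | rfl
        · simp [hneg, hpq]
        · simp [hneg, hq0, sq]
      | 1 =>
        rcases Int.units_eq_one_or ε with rfl | rfl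
        · simp [hneg, hq0]
        · simp [hneg, ← hpq, sq]
      | k + 2 =>
        rw [Equiv.swap_apply_of_ne_of_ne (by simp) (by simp)]
        rw [if_neg (by simp)]
        simp only
        split_ifs
        · rw [hpf (k + 2) (by lia) 0 (by lia) (by lia) (by lia) (by lia)]
        · rw [hqf (k + 2) (by lia) 0 (by lia) (by lia) (by lia) (by lia)]
    · rw [toPerm_gen_of_pos _ _ hi0]
      obtain ⟨i, rfl⟩ : ∃ j, i = j + 1 := ⟨i - 1, by lia⟩
      by_cases h1 : k = i
      · subst h1
        rcases Int.units_eq_one_or ε with rfl | rfl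
        · simp [hp' k (by lia), sq (k + 1) (by lia)]
        · simp [hneg, hq' k (by lia)]
      by_cases h2 : k = i + 1
      · subst h2
        rcases Int.units_eq_one_or ε with rfl | rfl
        · simp [hp' i (by lia)]
        · simp [hneg, hq' i (by lia), sq (i + 1) (by lia)]
      · rw [Equiv.swap_apply_of_ne_of_ne (by simpa using h1) (by simpa using h2)]
        simp only
        split_ifs
        · rw [hpf k (by lia) (i + 1) (by lia) (by lia) (by lia) (by lia)]
        · rw [hqf k (by lia) (i + 1) (by lia) (by lia) (by lia) (by lia)]

/-- The stabilizer of the last basis vector is the parabolic subgroup on the first `n`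
generators. -/
theorem mem_range_incl (hn : 2 ≤ n) {w : CoxeterGroupD (n + 1)}
    (hw : toPerm (by lia) w (Fin.last n, 1) = (Fin.last n, 1)) : w ∈ (incl n).range := by
  obtain ⟨f, hf, hfw⟩ := exists_equivariant hn
    ((1 : CoxeterGroupD (n + 1)) : CoxeterGroupD (n + 1) ⧸ (incl n).range) fun i hi ↦ by
      rw [MulAction.Quotient.smul_coe, QuotientGroup.eq]
      rw [← incl_gen hi]
      simp
  have h := hfw w (Fin.last n, 1)
  rw [hw, hf, MulAction.Quotient.smul_coe, QuotientGroup.eq] at h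
  simpa using h

theorem toPerm_injective (hn : 2 ≤ n) : Function.Injective (toPerm hn) := by
  rw [injective_iff_map_eq_one]
  induction n, hn using Nat.le_induction with
  | base =>
    have mem (w : CoxeterGroupD 2) :
        w = 1 ∨ w = gen 2 0 (by lia) ∨ w = gen 2 1 (by lia) ∨
          w = gen 2 0 (by lia) * gen 2 1 (by lia) := by
      induction w using induction_left with
      | one => exact Or.inl rfl
      | mul i hi w ih =>
        have hc := gen_commute (n := 2) (i := 0) (j := 1) (by lia) (by lia) (by decide) (by decide)
        interval_cases i <;> rcases ih with rfl | rfl | rfl | rfl <;>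
          simp [gen_mul_self, ← mul_assoc, ← hc]
        simp [mul_assoc, gen_mul_self]
    intro w hw
    have h0 := congrArg (fun σ ↦ σ (0, 1)) hw
    rcases mem w with rfl | rfl | rfl | rfl
    · rfl
    · simp [toPerm_gen_zero] at h0
    · simp [toPerm_gen_of_pos] at h0
    · simp [toPerm_gen_of_pos, toPerm_gen_zero] at h0
  | succ n hn ih =>
    intro w hw
    obtain ⟨w, rfl⟩ := mem_range_incl hn (w := w) (by rw [hw]; rfl)
    rw [ih w, map_one]
    refine Equiv.ext fun x ↦ ?_
    have h := toPerm_incl hn w x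
    rw [hw] at h
    exact Prod.ext (Fin.castSucc_injective n (congrArg Prod.fst h)).symm (congrArg Prod.snd h).symm

theorem toSignedPerm_injective (hn : 2 ≤ n) : Function.Injective (toSignedPerm hn) :=
  Function.Injective.of_comp (f := SignedPerm.toPerm n) (toPerm_injective hn)

end CoxeterGroupD

/-! ### The image and the order of `W(D_n)` -/

namespace SignedPerm

variable {n : ℕ}

theorem signVec_comp_inv (σ : Equiv.Perm (Fin n)) (p q : Fin n) :
    mulAutArrow (M := ℤˣ) σ (signVec {p, q}) = signVec {σ p, σ q} := by
  funext i
  change signVec {p, q} (σ⁻¹ i) = _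
  simp [signVec, Equiv.Perm.inv_def, Equiv.symm_apply_eq]

theorem signVec_pair {a b : Fin n} (hab : a ≠ b) :
    signVec {a, b} = Pi.mulSingle a (-1) * Pi.mulSingle b (-1) := by
  funext i
  by_cases ha : i = a
  · subst ha; simp [signVec, hab]
  by_cases hb : i = b
  · subst hb; simp [signVec, ha]
  · simp [signVec, ha, hb]

theorem exists_perm_apply_eq {p q a b : Fin n} (hpq : p ≠ q) (hab : a ≠ b) :
    ∃ τ : Equiv.Perm (Fin n), τ p = a ∧ τ q = b := by
  refine ⟨Equiv.swap (Equiv.swap p a q) b * Equiv.swap p a, ?_, by simp⟩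
  have h : Equiv.swap p a q ≠ a := fun h ↦
    hpq.symm <| (Equiv.swap p a).injective <| h.trans (Equiv.swap_apply_left p a).symm
  simp [Equiv.swap_apply_of_ne_of_ne h.symm hab]

/-- The sign vectors of product `1` are generated by those with exactly two entries `-1`. -/
theorem mem_of_prod_eq_one {S : Subgroup (Fin n → ℤˣ)} (a : Fin n)
    (hS : ∀ b, a ≠ b → signVec {a, b} ∈ S) {v : Fin n → ℤˣ} (hv : ∏ i, v i = 1) : v ∈ S := by
  -- Any vector belongs to `S` after its value at `a` is corrected so as to make the product `1`.
  have key : Pi.mulSingle a (∏ i, v i) * v ∈ S := by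
    clear hv
    induction v using Pi.mulSingle_induction with
    | one => simp [S.one_mem]
    | mul f g hf hg =>
      have : Pi.mulSingle a (∏ i, (f * g) i) * (f * g) =
          (Pi.mulSingle a (∏ i, f i) * f) * (Pi.mulSingle a (∏ i, g i) * g) := by
        simp only [Pi.mul_apply, Finset.prod_mul_distrib, Pi.mulSingle_mul]
        ac_rfl
      rw [this]
      exact S.mul_mem hf hg
    | mulSingle i u =>
      rw [Finset.prod_pi_mulSingle']
      rcases Int.units_eq_one_or u with rfl | rfl
      · simp [S.one_mem]
      · by_cases hi : a = i
        · subst hi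
          simp [← Pi.mulSingle_mul, S.one_mem]
        · simpa [signVec_pair hi] using hS i hi
  simpa [hv] using key

instance : Finite (SignedPerm n) := Finite.of_equiv _ SemidirectProduct.equivProd.symm

theorem conj_inl (k : SignedPerm n) (v : Fin n → ℤˣ) :
    k * SemidirectProduct.inl v * k⁻¹ =
      SemidirectProduct.inl (mulAutArrow (M := ℤˣ) k.right v) := by
  refine SemidirectProduct.ext (funext fun i ↦ ?_) (by simp)
  change k.left i * v (k.right⁻¹ i) * (k.left (k.right⁻¹⁻¹ ((k.right * 1)⁻¹ i)))⁻¹ =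
    v (k.right⁻¹ i)
  simp [mul_right_comm]

theorem card (n : ℕ) : Nat.card (SignedPerm n) = 2 ^ n * n.factorial := by
  rw [SemidirectProduct.card, Nat.card_perm]
  simp

theorem card_ker_parity (hn : 1 ≤ n) : Nat.card (parity n).ker = 2 ^ (n - 1) * n.factorial := by
  have hsurj : Function.Surjective (parity n) := fun u ↦
    ⟨SemidirectProduct.inl (Pi.mulSingle ⟨0, hn⟩ u), by simp [parity_apply]⟩
  have h := (parity n).ker.card_mul_index
  rw [Subgroup.index_ker, MonoidHom.range_eq_top.2 hsurj, card] at h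
  obtain ⟨m, rfl⟩ : ∃ m, n = m + 1 := ⟨n - 1, by lia⟩
  simp only [Subgroup.card_top, Nat.card_eq_fintype_card, Fintype.card_units_int] at h
  rw [Nat.add_sub_cancel]
  have h' : 2 ^ (m + 1) * (m + 1).factorial = 2 ^ m * (m + 1).factorial * 2 := by ring
  lia

end SignedPerm

namespace CoxeterGroupD

variable {n : ℕ}

theorem toSignedPerm_mem_ker (hn : 2 ≤ n) (w : CoxeterGroupD n) :
    toSignedPerm hn w ∈ (parity n).ker := by
  induction w using induction_left with
  | one => simp
  | mul i hi w ih =>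
    rw [map_mul]
    refine mul_mem ?_ ih
    rw [toSignedPerm_gen, MonoidHom.mem_ker, parity_apply]
    simp only [signedGen, reflection]
    by_cases hi0 : i = 0
    · subst hi0
      have := prod_signVec ({⟨0, by lia⟩, ⟨1, hn⟩} : Finset (Fin n))
      rw [Finset.card_pair (by simp)] at this
      simpa [signVec] using this
    · simp [hi0]

theorem inr_mem_range (hn : 2 ≤ n) (σ : Equiv.Perm (Fin n)) :
    SemidirectProduct.inr σ ∈ (toSignedPerm hn).range := by
  obtain ⟨m, rfl⟩ : ∃ m, n = m + 1 := ⟨n - 1, by lia⟩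
  have hσ : σ ∈ Submonoid.closure
      (Set.range fun i : Fin m ↦ Equiv.swap i.castSucc i.succ) := by
    rw [Equiv.Perm.mclosure_swap_castSucc_succ]; trivial
  induction hσ using Submonoid.closure_induction with
  | one => simp
  | mul x y _ _ hx hy => rw [map_mul]; exact mul_mem hx hy
  | mem x hx =>
    obtain ⟨i, rfl⟩ := hx
    refine ⟨gen (m + 1) (i + 1) (by lia), ?_⟩
    rw [toSignedPerm_gen]
    refine SemidirectProduct.ext (funext fun j ↦ by simp [signedGen, reflection]) ?_
    simp [signedGen, reflection, Fin.castSucc, Fin.succ]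
    rfl

theorem inl_signVec_mem_range (hn : 2 ≤ n) {a b : Fin n} (hab : a ≠ b) :
    SemidirectProduct.inl (signVec {a, b}) ∈ (toSignedPerm hn).range := by
  have h01 : SemidirectProduct.inl (signVec {⟨0, by lia⟩, ⟨1, hn⟩}) ∈ (toSignedPerm hn).range := by
    refine ⟨gen n 0 (by lia) * gen n 1 hn, ?_⟩
    rw [map_mul, toSignedPerm_gen, toSignedPerm_gen]
    refine SemidirectProduct.ext (funext fun j ↦ ?_) ?_
    · simp [mul_left_apply, signedGen, reflection, signVec]
    · simp [signedGen, reflection]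
  obtain ⟨τ, rfl, rfl⟩ := exists_perm_apply_eq (p := ⟨0, by lia⟩) (q := ⟨1, hn⟩) (by simp) hab
  rw [← signVec_comp_inv, SemidirectProduct.inl_aut]
  exact mul_mem (mul_mem (inr_mem_range hn τ) h01) (inv_mem (inr_mem_range hn τ))

theorem range_toSignedPerm (hn : 2 ≤ n) : (toSignedPerm hn).range = (parity n).ker := by
  refine le_antisymm ?_ fun g hg ↦ ?_
  · rintro _ ⟨w, rfl⟩
    exact toSignedPerm_mem_ker hn w
  · rw [← SemidirectProduct.inl_left_mul_inr_right g]
    refine mul_mem ?_ (inr_mem_range hn _)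
    exact mem_of_prod_eq_one (S := (toSignedPerm hn).range.comap SemidirectProduct.inl) ⟨0, by lia⟩
      (fun b hb ↦ inl_signVec_mem_range hn hb) hg

/-- `W(D_n)` is the group of signed permutations with an even number of sign changes. -/
noncomputable def equivKerParity (hn : 2 ≤ n) : CoxeterGroupD n ≃* (parity n).ker :=
  (MonoidHom.ofInjective (toSignedPerm_injective hn)).trans
    (MulEquiv.subgroupCongr (range_toSignedPerm hn))

theorem card (hn : 2 ≤ n) : Nat.card (CoxeterGroupD n) = 2 ^ (n - 1) * n.factorial := by
  rw [Nat.card_congr (equivKerParity hn).toEquiv, card_ker_parity (by lia)]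

end CoxeterGroupD

/-! ### Subgroups of small index -/

/-- A subgroup of index less than `n` in the symmetric group of degree `n ≥ 5` contains the
alternating group: its normal core is not trivial since `(n - 1)! < n!`. -/
theorem alternatingGroup_le_of_index_lt {n : ℕ} (hn : 5 ≤ n) {L : Subgroup (Equiv.Perm (Fin n))}
    (hL : L.index < n) : alternatingGroup (Fin n) ≤ L := by
  refine le_trans ?_ L.normalCore_le
  refine Equiv.Perm.alternatingGroup_le_of_normal (by simpa using hn) ?_
  rw [Subgroup.nontrivial_iff_ne_bot]
  intro hbot
  rw [Subgroup.normalCore_eq_ker, MonoidHom.ker_eq_bot_iff] at hbot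
  have h := Nat.card_le_card_of_injective _ hbot
  rw [Nat.card_perm, Nat.card_perm, Nat.card_fin] at h
  have h' : L.index.factorial ≤ (n - 1).factorial := Nat.factorial_le (by lia)
  have h'' : (n - 1).factorial < n.factorial := (Nat.factorial_lt (by lia)).2 (by lia)
  exact absurd h (by rw [← Subgroup.index]; lia)

namespace SignedPerm

variable {n : ℕ}

/-- The intersection of a group `H` of even signed permutations with the pure sign changes, as a
group of sign vectors. -/
def signSubgroup (H : Subgroup (parity n).ker) : Subgroup (Fin n → ℤˣ) :=
  (H.map (parity n).ker.subtype).comap SemidirectProduct.inl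

theorem mem_signSubgroup {H : Subgroup (parity n).ker} {v : Fin n → ℤˣ} :
    v ∈ signSubgroup H ↔ ∃ h ∈ H, (h : SignedPerm n) = SemidirectProduct.inl v := Iff.rfl

theorem coe_mem_signSubgroup {H : Subgroup (parity n).ker} {v : Fin n → ℤˣ}
    (hv : SemidirectProduct.inl v ∈ (parity n).ker) :
    v ∈ signSubgroup H ↔ (⟨SemidirectProduct.inl v, hv⟩ : (parity n).ker) ∈ H := by
  rw [mem_signSubgroup]
  constructor
  · rintro ⟨h, hh, hv'⟩
    rwa [← Subtype.ext (a1 := h) (a2 := ⟨_, hv⟩) hv']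
  · exact fun h ↦ ⟨_, h, rfl⟩

theorem inl_signVec_mem_ker {s : Finset (Fin n)} (hs : s.card = 2) :
    SemidirectProduct.inl (signVec s) ∈ (parity n).ker := by
  rw [MonoidHom.mem_ker, parity_apply, SemidirectProduct.left_inl, prod_signVec, hs]
  rfl

/-- A subgroup of index less than `2 * n` which does not contain all the sign changes has an image
of index less than `n` in the symmetric group, so this image contains the alternating group. -/
theorem exists_mem_right_eq (hn : 5 ≤ n) {H : Subgroup (parity n).ker} (hH : H.index < 2 * n)
    {v : Fin n → ℤˣ} (hv : ∏ i, v i = 1) (hvH : v ∉ signSubgroup H)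
    {σ : Equiv.Perm (Fin n)} (hσ : σ ∈ alternatingGroup (Fin n)) :
    ∃ h ∈ H, (h : SignedPerm n).right = σ := by
  set π : (parity n).ker →* Equiv.Perm (Fin n) :=
    SemidirectProduct.rightHom.comp (parity n).ker.subtype with hπ
  have hsurj : Function.Surjective π := fun σ ↦
    ⟨⟨SemidirectProduct.inr σ, by simp [MonoidHom.mem_ker, parity_apply]⟩, rfl⟩
  have hlt : (H.map π).index < n := by
    have hrange : π.range = ⊤ := MonoidHom.range_eq_top.2 hsurj
    rw [Subgroup.index_map, hrange, Subgroup.index_top, mul_one]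
    have hmul := Subgroup.relIndex_mul_index (le_sup_left : H ≤ H ⊔ π.ker)
    have h0 : H.relIndex (H ⊔ π.ker) ≠ 0 := Subgroup.index_ne_zero_of_finite
    have h1 : H.relIndex (H ⊔ π.ker) ≠ 1 := by
      rw [ne_eq, Subgroup.relIndex_eq_one]
      intro hle
      have hv' : SemidirectProduct.inl v ∈ (parity n).ker := hv
      refine hvH ((coe_mem_signSubgroup hv').2 (hle (Subgroup.mem_sup_right ?_)))
      simp [hπ, MonoidHom.mem_ker]
    have h2 : 2 ≤ H.relIndex (H ⊔ π.ker) := by lia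
    nlinarith
  obtain ⟨h, hh, rfl⟩ := alternatingGroup_le_of_index_lt hn hlt hσ
  exact ⟨h, hh, rfl⟩

theorem mulAutArrow_mem_signSubgroup {H : Subgroup (parity n).ker} {h : (parity n).ker}
    (hh : h ∈ H) {v : Fin n → ℤˣ} (hv : v ∈ signSubgroup H) :
    mulAutArrow (M := ℤˣ) (h : SignedPerm n).right v ∈ signSubgroup H := by
  obtain ⟨g, hg, hgv⟩ := hv
  refine ⟨h * g * h⁻¹, mul_mem (mul_mem hh hg) (inv_mem hh), ?_⟩
  rw [map_mul, map_mul, map_inv, hgv, Subgroup.coe_subtype, conj_inl]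

/-- If the alternating group preserves a group of sign vectors containing a nonconstant one, then
this group contains all the sign changes of two coordinates: if `v p ≠ v q = v r`, the product
of `v` and its translate under the cycle `(p q r)` is the sign change of `p` and `q`. -/
theorem signVec_pair_mem {N : Subgroup (Fin n → ℤˣ)} (hn : 3 ≤ n)
    (hN : ∀ σ ∈ alternatingGroup (Fin n), ∀ v ∈ N, mulAutArrow (M := ℤˣ) σ v ∈ N)
    {v : Fin n → ℤˣ} (hv : v ∈ N) {p q : Fin n} (hpq : v p ≠ v q) {a b : Fin n} (hab : a ≠ b) :
    signVec {a, b} ∈ N := by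
  obtain ⟨p, q, r, hpq, hqr, hpr, hv1, hv2⟩ :
      ∃ p q r : Fin n, p ≠ q ∧ q ≠ r ∧ p ≠ r ∧ v p ≠ v q ∧ v r = v q := by
    obtain ⟨r, hr⟩ : ∃ r : Fin n, r ∉ ({p, q} : Finset (Fin n)) := by
      by_contra! h
      have := Finset.card_le_card (show Finset.univ ⊆ ({p, q} : Finset (Fin n)) from fun x _ ↦ h x)
      have := Finset.card_le_two (a := p) (b := q)
      simp at *
      lia
    simp only [Finset.mem_insert, Finset.mem_singleton, not_or] at hr
    have hne : p ≠ q := fun h ↦ hpq (by rw [h])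
    have hrp : p ≠ r := Ne.symm hr.1
    have hrq : q ≠ r := Ne.symm hr.2
    by_cases h : v r = v q
    · exact ⟨p, q, r, hne, hrq, hrp, hpq, h⟩
    · refine ⟨q, p, r, hne.symm, hrp, hrq, hpq.symm, ?_⟩
      rcases Int.units_eq_one_or (v p) with h1 | h1 <;>
      rcases Int.units_eq_one_or (v q) with h2 | h2 <;>
      rcases Int.units_eq_one_or (v r) with h3 | h3 <;> simp_all
  have hsign : v p * v q = -1 := by
    rcases Int.units_eq_one_or (v p) with h1 | h1 <;>
    rcases Int.units_eq_one_or (v q) with h2 | h2 <;> simp_all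
  have hmem : signVec {p, q} ∈ N := by
    have hcycle : Equiv.swap p q * Equiv.swap q r ∈ alternatingGroup (Fin n) := by
      simp [Equiv.Perm.mem_alternatingGroup, hpq, hqr]
    convert N.mul_mem hv (hN _ hcycle v hv) using 1
    funext i
    change _ = v i * v ((Equiv.swap p q * Equiv.swap q r)⁻¹ i)
    rw [mul_inv_rev, Equiv.swap_inv, Equiv.swap_inv, Equiv.Perm.mul_apply]
    by_cases h1 : i = p
    · subst h1
      simp [signVec, hv2, hsign]
    by_cases h2 : i = q
    · subst h2
      simp [signVec, Equiv.swap_apply_of_ne_of_ne hpq hpr, mul_comm (v i), hsign]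
    by_cases h3 : i = r
    · subst h3
      simp [signVec, h1, h2, Equiv.swap_apply_of_ne_of_ne h1 h2, hv2]
    · simp [signVec, h1, h2, Equiv.swap_apply_of_ne_of_ne h1 h2, Equiv.swap_apply_of_ne_of_ne h2 h3]
  obtain ⟨τ, rfl, rfl⟩ := exists_perm_apply_eq hpq hab
  -- Of `τ` and `τ * swap p q`, which have the same effect on `{p, q}`, one is even.
  rcases Int.units_eq_one_or (Equiv.Perm.sign τ) with h | h
  · rw [← signVec_comp_inv]
    exact hN τ (Equiv.Perm.mem_alternatingGroup.2 h) _ hmem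
  · have := hN (τ * Equiv.swap p q) (by simp [Equiv.Perm.mem_alternatingGroup, h, hpq]) _ hmem
    rw [signVec_comp_inv] at this
    simpa [Finset.pair_comm] using this

theorem signVec_mul_signVec_ne {s t : Finset (Fin n)} (hn : s.card + t.card < n) (hst : s ≠ t) :
    ∃ p q, (signVec s * signVec t) p ≠ (signVec s * signVec t) q := by
  obtain ⟨p, hp⟩ : ∃ p, ¬ (p ∈ s ↔ p ∈ t) := by
    by_contra! h
    exact hst (Finset.ext h)
  obtain ⟨q, hq⟩ : ∃ q, q ∉ s ∪ t := by
    by_contra! h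
    have h1 := Finset.card_le_card (show Finset.univ ⊆ s ∪ t from fun x _ ↦ h x)
    have h2 := Finset.card_union_le s t
    rw [Finset.card_univ, Fintype.card_fin] at h1
    lia
  refine ⟨p, q, ?_⟩
  simp only [Finset.mem_union, not_or] at hq
  simp only [Pi.mul_apply, signVec, hq.1, hq.2, if_false, mul_one]
  by_cases h : p ∈ s
  · have : p ∉ t := by tauto
    simp [h, this]
  · have : p ∈ t := by tauto
    simp [h, this]

/-- For `n ≥ 5`, a subgroup of index less than `2 * n` contains all the sign changes of two
coordinates. -/
theorem signVec_mem_signSubgroup (hn : 5 ≤ n) {H : Subgroup (parity n).ker}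
    (hH : H.index < 2 * n) {a b : Fin n} (hab : a ≠ b) : signVec {a, b} ∈ signSubgroup H := by
  by_contra hvH
  have hprod : ∏ i, signVec {a, b} i = 1 := inl_signVec_mem_ker (Finset.card_pair hab)
  have hN : ∀ σ ∈ alternatingGroup (Fin n), ∀ v ∈ signSubgroup H,
      mulAutArrow (M := ℤˣ) σ v ∈ signSubgroup H := by
    intro σ hσ v hv
    obtain ⟨h, hh, rfl⟩ := exists_mem_right_eq hn hH hprod hvH hσ
    exact mulAutArrow_mem_signSubgroup hh hv
  -- Only constant sign vectors lie in `H`, so sign changes of distinct pairs are in distinct cosets,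
  -- of which there are therefore at least `n.choose 2`.
  let F : Finset.powersetCard 2 (Finset.univ : Finset (Fin n)) → (parity n).ker ⧸ H := fun s ↦
    ((⟨SemidirectProduct.inl (signVec s), inl_signVec_mem_ker (Finset.mem_powersetCard.1 s.2).2⟩ :
      (parity n).ker) : (parity n).ker ⧸ H)
  have hF : Function.Injective F := by
    rintro ⟨s, hs⟩ ⟨t, ht⟩ hst
    by_contra hne
    have hne' : s ≠ t := fun h ↦ hne (Subtype.ext h)
    obtain ⟨p, q, hpq⟩ := signVec_mul_signVec_ne
      (by rw [(Finset.mem_powersetCard.1 hs).2, (Finset.mem_powersetCard.1 ht).2]; lia) hne'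
    rw [QuotientGroup.eq] at hst
    refine hvH (signVec_pair_mem (by lia) hN (v := signVec s * signVec t) ?_ hpq hab)
    refine mem_signSubgroup.2 ⟨_, hst, ?_⟩
    rw [Subgroup.coe_mul, Subgroup.coe_inv, ← map_inv, ← map_mul]
    congr 2
    funext i
    exact Int.units_inv_eq_self _
  have hcard := Nat.card_le_card_of_injective F hF
  rw [← Subgroup.index, Nat.card_eq_fintype_card, Fintype.card_coe, Finset.card_powersetCard,
    Finset.card_univ, Fintype.card_fin, Nat.choose_two_right] at hcard
  have h1 : 4 * n ≤ n * (n - 1) := by rw [mul_comm]; exact Nat.mul_le_mul_left n (by lia)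
  lia

end SignedPerm

/-! ### Faithful permutation representations of `W(D_n)` -/

namespace CoxeterGroupD

variable {n : ℕ}

theorem exists_injective_perm_two_mul (hn : 2 ≤ n) :
    ∃ f : CoxeterGroupD n →* Equiv.Perm (Fin (2 * n)), Function.Injective f := by
  have e : Fin n × ℤˣ ≃ Fin (2 * n) := Fintype.equivFinOfCardEq (by simp [mul_comm])
  exact ⟨e.permCongrHom.toMonoidHom.comp (toPerm hn),
    e.permCongrHom.injective.comp (toPerm_injective hn)⟩

/-- The diagram `0 --- 2 --- 1` of type `D_3` is that of the adjacent transpositions in the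
symmetric group of degree `4`. -/
theorem exists_injective_perm_four :
    ∃ f : CoxeterGroupD 3 →* Equiv.Perm (Fin 4), Function.Injective f := by
  have hf : (coxeterMatrixD 3).IsLiftable
      (![Equiv.swap 0 1, Equiv.swap 2 3, Equiv.swap 1 2] : Fin 3 → Equiv.Perm (Fin 4)) :=
    isLiftable (by decide) (by decide) (by decide)
  have hsurj : Function.Surjective (lift hf) := by
    intro σ
    have hσ : σ ∈ Submonoid.closure
        (Set.range fun i : Fin 3 ↦ Equiv.swap i.castSucc i.succ) := by
      rw [Equiv.Perm.mclosure_swap_castSucc_succ]; trivial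
    rw [← MonoidHom.mem_range]
    induction hσ using Submonoid.closure_induction with
    | one => exact one_mem _
    | mul x y _ _ hx hy => exact mul_mem hx hy
    | mem x hx =>
      obtain ⟨i, rfl⟩ := hx
      fin_cases i
      · exact ⟨gen 3 0 (by lia), lift_gen hf _⟩
      · exact ⟨gen 3 2 (by lia), lift_gen hf _⟩
      · exact ⟨gen 3 1 (by lia), lift_gen hf _⟩
  have hcard : Nat.card (CoxeterGroupD 3) = Nat.card (Equiv.Perm (Fin 4)) := by
    rw [card (by lia), Nat.card_perm, Nat.card_fin]
    rfl
  have : Finite (CoxeterGroupD 3) := Nat.finite_of_card_ne_zero (by rw [card (by lia)]; decide)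
  exact ⟨lift hf, ((Nat.bijective_iff_surjective_and_card _).2 ⟨hsurj, hcard⟩).1⟩

theorem card_dvd_factorial (hn : 2 ≤ n) {m : ℕ} {f : CoxeterGroupD n →* Equiv.Perm (Fin m)}
    (hf : Function.Injective f) : 2 ^ (n - 1) * n.factorial ∣ m.factorial := by
  have h := Subgroup.card_dvd_of_injective f hf
  rwa [card hn, Nat.card_perm, Nat.card_fin] at h

/-- For `n ≥ 5`, all the points of a set with fewer than `2 * n` elements are fixed by the sign
changes of two coordinates. -/
theorem two_mul_le_of_injective (hn : 5 ≤ n) {m : ℕ} {f : CoxeterGroupD n →* Equiv.Perm (Fin m)}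
    (hf : Function.Injective f) : 2 * n ≤ m := by
  by_contra! hm
  let F : (parity n).ker →* Equiv.Perm (Fin m) :=
    f.comp (equivKerParity (n := n) (by lia)).symm.toMonoidHom
  have hF : Function.Injective F := hf.comp (equivKerParity (n := n) (by lia)).symm.injective
  let _ : MulAction (parity n).ker (Fin m) := MulAction.compHom (Fin m) F
  have h01 : (⟨0, by lia⟩ : Fin n) ≠ ⟨1, by lia⟩ := by simp
  have hker := inl_signVec_mem_ker (Finset.card_pair h01)
  have hfix : F ⟨_, hker⟩ = 1 := by
    refine Equiv.ext fun x ↦ ?_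
    have hindex : (MulAction.stabilizer (parity n).ker x).index < 2 * n := by
      rw [MulAction.index_stabilizer]
      refine lt_of_le_of_lt (Set.ncard_le_card _) ?_
      simpa using hm
    exact (coe_mem_signSubgroup hker).1 (signVec_mem_signSubgroup hn hindex h01)
  have h1 := congrArg (fun g : (parity n).ker ↦ (g : SignedPerm n).left ⟨0, by lia⟩)
    (hF (hfix.trans (map_one F).symm))
  simp [signVec] at h1

end CoxeterGroupD

theorem minFaithfulPermDegree_eq {G : Type*} [Group G] {k : ℕ}
    (hk : ∃ f : G →* Equiv.Perm (Fin k), Function.Injective f)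
    (hle : ∀ (m : ℕ) (f : G →* Equiv.Perm (Fin m)), Function.Injective f → k ≤ m) :
    minFaithfulPermDegree G = k :=
  le_antisymm (Nat.sInf_le hk) (le_csInf ⟨k, hk⟩ fun m ⟨f, hf⟩ ↦ hle m f hf)

open CoxeterGroupD

theorem mainTheorem1 (n : ℕ) (hn : 2 ≤ n) :
    minFaithfulPermDegree (CoxeterGroupD n) = if n = 3 then 4 else 2 * n := by
  have hsmall {m k : ℕ} (hk : ¬ 2 ^ (n - 1) * n.factorial ∣ k.factorial)
      {f : CoxeterGroupD n →* Equiv.Perm (Fin m)} (hf : Function.Injective f) : k + 1 ≤ m := by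
    by_contra! hlt
    exact hk ((card_dvd_factorial hn hf).trans (Nat.factorial_dvd_factorial (by lia)))
  split_ifs with h3
  · subst h3
    exact minFaithfulPermDegree_eq exists_injective_perm_four fun m f hf ↦
      hsmall (k := 3) (by decide) hf
  · refine minFaithfulPermDegree_eq (exists_injective_perm_two_mul hn) fun m f hf ↦ ?_
    by_cases h5 : 5 ≤ n
    · exact two_mul_le_of_injective h5 hf
    · obtain rfl | rfl : n = 2 ∨ n = 4 := by lia
      · exact hsmall (k := 3) (by decide) hf
      · exact hsmall (k := 7) (by decide) hf
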